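/- Let $R$ be an associative ring with identity. For $n\ge 0$ let $L'_n(R)$ be the collection of pairs $(B\mid A)$ of matrices over $R$ with the same number of rows, where $A$ has $n$ columns, preordered by: $(B\mid A)\le_n(B'\mid A')$ if and only if there are matrices $U,V,G$ of appropriate sizes with $UB=B'V$ and $UA=A'+B'G$. Let $L_n(R)$ be the set of classes $[B\mid A]$ modulo the equivalence relation "$\le_n$ and $\ge_n$" (the $n$-ary matrix pairs), and write $[A]=[0\mid A]$. For a matrix $A=(A_0,\dots,A_n)$ with $n+1$ columns let $\hat A_i$ be $A$ with the column $A_i$ removed; the face operators $E_i,N_i:L_{n+1}(R)\to L_n(R)$, $0\le i\le n$, are $E_i[B\mid A]=[B,A_i\mid \hat A_i]$ and $N_i[B\mid A]=[B\mid\hat A_i]$. For $n\ge 0$ let $Q_n(R)$ be the free abelian group on $L_{n+1}(R)$, with $\partial_n=\sum_{i=0}^n(-1)^i(E_i-N_i):Q_n(R)\to Q_{n-1}(R)$ for $n\ge1$, and let $\partial_0:Q_0(R)\to Q_{-1}(R)=\mathbb Z$ be the augmentation sending each generator to $1$. For $n>0$ let $M_n(R)\subseteq Q_n(R)$ be the subgroup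 generated by the degenerate $(n+1)$-ary matrix pairs, i.e. those with $E_i[B\mid A]=N_i[B\mid A]$ for some $0\le i\le n$; let $M_0(R)=0$. These form a subcomplex; $C_*(R)=Q_*(R)/M_*(R)$ is the complex of nondegenerate matrix pairs, and for $n\ge 0$ its homology at $C_n(R)$ is denoted $H_n(R)$. Theorem. Let $k$ be a (not necessarily commutative) field, i.e. a division ring. For $r\in k^\times$ let $[1,r]\in L_2(k)$ be the matrix pair of the system with the $1\times 2$ coefficient matrix $(1,r)$. Its image in $C_1(k)$ is a cycle, and: 1. $H_1(k)$ is the abelian group generated by the symbols $[1,r]$, $r\in k^\times$, modulo the relations $[1,r]-[1,s]-[1,rs^{-1}]$ ($r,s\in k^\times$) and $[1,-1]$; that is, sending the symbol $[1,r]$ to the homology class of $[1,r]$ induces an isomorphism from the group so presented onto $H_1(k)$. 2. $H_1(k)\cong (k^\times)_{\mathrm{ab}}/\{\pm1\}$, by an isomorphism that sends the homology class of $[1,r]$ to the class of $r$. Here $(k^\times)_{\mathrm{ab}}$ is the abelianization of the multiplicative group of $k$, and $\{\pm 1\}$ denotes the image in it of the subgroup $\{1,-1\}$ of $k^\times$.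 -/

import Mathlib

namespace LinAlgRing

universe u

/-- A pair `(B | A)` of matrices over `R` with the same number `rows` of rows, where `A` has `n`
columns and `B` has any number `cols` of columns: an element of `L'_n(R)`. -/
structure PrePair (R : Type u) (n : ℕ) where
  rows : ℕ
  cols : ℕ
  B : Matrix (Fin rows) (Fin cols) R
  A : Matrix (Fin rows) (Fin n) R

/-- `(B | A) ≤ (B' | A')` when there are matrices `U, V, G` with `U B = B' V` and
`U A = A' + B' G`. -/
def PrePair.Le {R : Type u} [Ring R] {n : ℕ} (p q : PrePair R n) : Prop :=
  ∃ (U : Matrix (Fin q.rows) (Fin p.rows) R) (V : Matrix (Fin q.cols) (Fin p.cols) R)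
    (G : Matrix (Fin q.cols) (Fin n) R), U * p.B = q.B * V ∧ U * p.A = q.A + q.B * G

theorem PrePair.Le.refl {R : Type u} [Ring R] {n : ℕ} (p : PrePair R n) : p.Le p :=
  ⟨1, 1, 0, by simp, by simp⟩

theorem PrePair.Le.trans {R : Type u} [Ring R] {n : ℕ} {p q r : PrePair R n}
    (h : p.Le q) (h' : q.Le r) : p.Le r := by
  obtain ⟨U, V, G, h1, h2⟩ := h
  obtain ⟨U', V', G', h3, h4⟩ := h'
  refine ⟨U' * U, V' * V, G' + V' * G, ?_, ?_⟩
  · rw [Matrix.mul_assoc, h1, ← Matrix.mul_assoc, h3, Matrix.mul_assoc]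
  · rw [Matrix.mul_assoc, h2, Matrix.mul_add, h4, ← Matrix.mul_assoc, h3, Matrix.mul_add,
      Matrix.mul_assoc, add_assoc]

instance PrePair.instPreorder (R : Type u) [Ring R] (n : ℕ) : Preorder (PrePair R n) where
  le p q := p.Le q
  le_refl p := PrePair.Le.refl p
  le_trans _ _ _ h h' := PrePair.Le.trans h h'

/-- The partially ordered set `L_n(R)` of `n`-ary matrix pairs: the elements of `L'_n(R)` modulo
`p ≤ q ∧ q ≤ p`. -/
abbrev MatrixPair (R : Type u) [Ring R] (n : ℕ) : Type u :=
  Antisymmetrization (PrePair R n) (· ≤ ·)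

/-- The matrix pair `[A] = [0 | A]` of a homogeneous system with matrix of coefficients `A`. -/
def system {R : Type u} [Ring R] {m n : ℕ} (A : Matrix (Fin m) (Fin n) R) : MatrixPair R n :=
  toAntisymmetrization (· ≤ ·) (⟨m, 1, 0, A⟩ : PrePair R n)

/-- Bottom `i`-face: delete the `i`-th column of `A`. -/
def PrePair.bot {R : Type u} {n : ℕ} (i : Fin (n + 1)) (p : PrePair R (n + 1)) : PrePair R n :=
  ⟨p.rows, p.cols, p.B, p.A.submatrix id i.succAbove⟩

/-- Top `i`-face: move the `i`-th column of `A` to the right end of `B`. -/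
def PrePair.top {R : Type u} {n : ℕ} (i : Fin (n + 1)) (p : PrePair R (n + 1)) : PrePair R n :=
  ⟨p.rows, p.cols + 1, Matrix.of fun x => Fin.snoc (α := fun _ => R) (p.B x) (p.A x i),
    p.A.submatrix id i.succAbove⟩

/-- The order relation read off one column at a time. -/
theorem PrePair.mk_le_mk {R : Type u} [Ring R] {n m k m' k' : ℕ}
    {B : Matrix (Fin m) (Fin k) R} {A : Matrix (Fin m) (Fin n) R}
    {B' : Matrix (Fin m') (Fin k') R} {A' : Matrix (Fin m') (Fin n) R} :
    (⟨m, k, B, A⟩ : PrePair R n) ≤ ⟨m', k', B', A'⟩ ↔ ∃ U : Matrix (Fin m') (Fin m) R,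
      (∀ j, ∃ v : Fin k' → R, ∀ x, ∑ z, U x z * B z j = ∑ y, B' x y * v y) ∧
      (∀ j, ∃ v : Fin k' → R, ∀ x, ∑ z, U x z * A z j = A' x j + ∑ y, B' x y * v y) := by
  constructor
  · rintro ⟨U, V, G, h1, h2⟩
    refine ⟨U, fun j => ⟨fun y => V y j, fun x => ?_⟩, fun j => ⟨fun y => G y j, fun x => ?_⟩⟩
    · exact congrFun (congrFun h1 x) j
    · exact congrFun (congrFun h2 x) j
  · rintro ⟨U, h1, h2⟩
    choose V hV using h1
    choose G hG using h2
    refine ⟨U, Matrix.of fun y j => V j y, Matrix.of fun y j => G j y, ?_, ?_⟩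
    · ext x j
      exact hV j x
    · ext x j
      exact hG j x

theorem PrePair.bot_mono {R : Type u} [Ring R] {n : ℕ} (i : Fin (n + 1)) :
    Monotone (PrePair.bot i : PrePair R (n + 1) → PrePair R n) := by
  rintro ⟨m, k, B, A⟩ ⟨m', k', B', A'⟩ h
  obtain ⟨U, h1, h2⟩ := PrePair.mk_le_mk.1 h
  exact PrePair.mk_le_mk.2 ⟨U, h1, fun j => h2 (i.succAbove j)⟩

theorem PrePair.top_mono {R : Type u} [Ring R] {n : ℕ} (i : Fin (n + 1)) :
    Monotone (PrePair.top i : PrePair R (n + 1) → PrePair R n) := by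
  rintro ⟨m, k, B, A⟩ ⟨m', k', B', A'⟩ h
  obtain ⟨U, h1, h2⟩ := PrePair.mk_le_mk.1 h
  refine PrePair.mk_le_mk.2 ⟨U, fun j => ?_, fun j => ?_⟩
  · refine Fin.lastCases ?_ (fun j => ?_) j
    · obtain ⟨v, hv⟩ := h2 i
      exact ⟨Fin.snoc (α := fun _ => R) v 1, fun x => by
        simp [Fin.sum_univ_castSucc, hv x, add_comm]⟩
    · obtain ⟨v, hv⟩ := h1 j
      exact ⟨Fin.snoc (α := fun _ => R) v 0, fun x => by simp [Fin.sum_univ_castSucc, hv x]⟩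
  · obtain ⟨v, hv⟩ := h2 (i.succAbove j)
    exact ⟨Fin.snoc (α := fun _ => R) v 0, fun x => by simp [Fin.sum_univ_castSucc, hv x]⟩

/-- The bottom face operator `N_i : L_{n+1}(R) → L_n(R)`, `[B | A] ↦ [B | Â_i]`. -/
def faceN {R : Type u} [Ring R] {n : ℕ} (i : Fin (n + 1)) :
    MatrixPair R (n + 1) →o MatrixPair R n :=
  OrderHom.antisymmetrization ⟨PrePair.bot i, PrePair.bot_mono i⟩

/-- The top face operator `E_i : L_{n+1}(R) → L_n(R)`, `[B | A] ↦ [B, A_i | Â_i]`. -/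
def faceE {R : Type u} [Ring R] {n : ℕ} (i : Fin (n + 1)) :
    MatrixPair R (n + 1) →o MatrixPair R n :=
  OrderHom.antisymmetrization ⟨PrePair.top i, PrePair.top_mono i⟩

theorem succAbove_comm {n : ℕ} {i j : Fin (n + 1)} (h : i ≤ j) (x : Fin n) :
    j.succ.succAbove (i.succAbove x) = i.castSucc.succAbove (j.succAbove x) := by
  simp only [Fin.succAbove, Fin.lt_def, Fin.le_def] at *
  ext
  split_ifs <;> simp at * <;> omega

theorem succ_succAbove_of_le {n : ℕ} {i j : Fin (n + 1)} (h : i ≤ j) :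
    j.succ.succAbove i = i.castSucc :=
  Fin.succAbove_of_castSucc_lt _ _ (by simp only [Fin.lt_def, Fin.le_def] at *; simp; omega)

theorem castSucc_succAbove_of_le {n : ℕ} {i j : Fin (n + 1)} (h : i ≤ j) :
    i.castSucc.succAbove j = j.succ :=
  Fin.succAbove_of_le_castSucc _ _ (by simp only [Fin.le_def] at *; simpa using h)

theorem faceN_faceN {R : Type u} [Ring R] {n : ℕ} {i j : Fin (n + 1)} (h : i ≤ j)
    (p : MatrixPair R (n + 2)) :
    faceN i (faceN j.succ p) = faceN j (faceN i.castSucc p) := by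
  induction p using Quotient.inductionOn with | _ p
  refine congrArg (toAntisymmetrization (· ≤ ·)) ?_
  simp [PrePair.bot, Matrix.submatrix_submatrix, Function.comp_def, succAbove_comm h]

theorem faceN_faceE {R : Type u} [Ring R] {n : ℕ} {i j : Fin (n + 1)} (h : i ≤ j)
    (p : MatrixPair R (n + 2)) :
    faceN i (faceE j.succ p) = faceE j (faceN i.castSucc p) := by
  induction p using Quotient.inductionOn with | _ p
  refine congrArg (toAntisymmetrization (· ≤ ·)) ?_
  simp [PrePair.bot, PrePair.top, Matrix.submatrix_submatrix, Function.comp_def,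
    succAbove_comm h, castSucc_succAbove_of_le h]

theorem faceE_faceN {R : Type u} [Ring R] {n : ℕ} {i j : Fin (n + 1)} (h : i ≤ j)
    (p : MatrixPair R (n + 2)) :
    faceE i (faceN j.succ p) = faceN j (faceE i.castSucc p) := by
  induction p using Quotient.inductionOn with | _ p
  refine congrArg (toAntisymmetrization (· ≤ ·)) ?_
  simp [PrePair.bot, PrePair.top, Matrix.submatrix_submatrix, Function.comp_def,
    succAbove_comm h, succ_succAbove_of_le h]

theorem PrePair.swap_le {R : Type u} [Ring R] {m k n : ℕ} (B : Matrix (Fin m) (Fin k) R)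
    (a b : Fin m → R) (A : Matrix (Fin m) (Fin n) R) :
    (⟨m, k + 1 + 1, Matrix.of fun x => Fin.snoc (α := fun _ => R)
        (Fin.snoc (α := fun _ => R) (B x) (a x)) (b x), A⟩ : PrePair R n) ≤
      ⟨m, k + 1 + 1, Matrix.of fun x => Fin.snoc (α := fun _ => R)
        (Fin.snoc (α := fun _ => R) (B x) (b x)) (a x), A⟩ := by
  refine PrePair.mk_le_mk.2 ⟨1, fun j => ?_, fun j => ⟨0, fun x => by simp [Matrix.one_apply]⟩⟩
  refine Fin.lastCases ?_ (fun j => Fin.lastCases ?_ (fun j => ?_) j) j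
  · exact ⟨Fin.snoc (α := fun _ => R) (Fin.snoc (α := fun _ => R) 0 1) 0, fun x => by
      simp [Fin.sum_univ_castSucc, Matrix.one_apply]⟩
  · exact ⟨Fin.snoc (α := fun _ => R) (Fin.snoc (α := fun _ => R) 0 0) 1, fun x => by
      simp [Fin.sum_univ_castSucc, Matrix.one_apply]⟩
  · exact ⟨Fin.snoc (α := fun _ => R) (Fin.snoc (α := fun _ => R) (Pi.single j 1) 0) 0,
      fun x => by simp [Fin.sum_univ_castSucc, Pi.single_apply, Matrix.one_apply]⟩

theorem faceE_faceE {R : Type u} [Ring R] {n : ℕ} {i j : Fin (n + 1)} (h : i ≤ j)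
    (p : MatrixPair R (n + 2)) :
    faceE i (faceE j.succ p) = faceE j (faceE i.castSucc p) := by
  induction p using Quotient.inductionOn with | _ p
  have e1 : PrePair.top i (PrePair.top j.succ p) =
      ⟨p.rows, p.cols + 1 + 1, Matrix.of fun x => Fin.snoc (α := fun _ => R)
        (Fin.snoc (α := fun _ => R) (p.B x) (p.A x j.succ)) (p.A x i.castSucc),
        p.A.submatrix id (fun x => i.castSucc.succAbove (j.succAbove x))⟩ := by
    simp [PrePair.top, Matrix.submatrix_submatrix, Function.comp_def,
      succAbove_comm h, succ_succAbove_of_le h]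
    rfl
  have e2 : PrePair.top j (PrePair.top i.castSucc p) =
      ⟨p.rows, p.cols + 1 + 1, Matrix.of fun x => Fin.snoc (α := fun _ => R)
        (Fin.snoc (α := fun _ => R) (p.B x) (p.A x i.castSucc)) (p.A x j.succ),
        p.A.submatrix id (fun x => i.castSucc.succAbove (j.succAbove x))⟩ := by
    simp [PrePair.top, Matrix.submatrix_submatrix, Function.comp_def, castSucc_succAbove_of_le h]
    rfl
  refine Quotient.sound (s := AntisymmRel.setoid _ _) ?_
  change AntisymmRel (· ≤ ·) (PrePair.top i (PrePair.top j.succ p))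
    (PrePair.top j (PrePair.top i.castSucc p))
  rw [e1, e2]
  exact ⟨PrePair.swap_le _ _ _ _, PrePair.swap_le _ _ _ _⟩

/-- The chain group `Q_n(R)`, `n ≥ 0`: the free abelian group on the `(n+1)`-ary matrix pairs. -/
abbrev Q (R : Type u) [Ring R] (n : ℕ) : Type u := FreeAbelianGroup (MatrixPair R (n + 1))

/-- The `i`-th term `E_i - N_i : Q_{n+1}(R) → Q_n(R)` of the boundary map. -/
def faceDiff (R : Type u) [Ring R] (n : ℕ) (i : Fin (n + 2)) : Q R (n + 1) →+ Q R n :=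
  FreeAbelianGroup.map (faceE i) - FreeAbelianGroup.map (faceN i)

/-- The boundary map `∂_{n+1} = ∑ (-1)^i (E_i - N_i) : Q_{n+1}(R) → Q_n(R)`. -/
def bdryQ (R : Type u) [Ring R] (n : ℕ) : Q R (n + 1) →+ Q R n :=
  ∑ i : Fin (n + 2), (-1 : ℤ) ^ (i : ℕ) • faceDiff R n i

/-- The augmentation `∂_0 : Q_0(R) → Q_{-1}(R) = ℤ`. -/
def augQ (R : Type u) [Ring R] : Q R 0 →+ ℤ := FreeAbelianGroup.lift fun _ => 1

theorem faceDiff_of {R : Type u} [Ring R] {n : ℕ} (i : Fin (n + 2)) (p : MatrixPair R (n + 2)) :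
    faceDiff R n i (FreeAbelianGroup.of p) =
      FreeAbelianGroup.of (faceE i p) - FreeAbelianGroup.of (faceN i p) := by
  simp [faceDiff]

theorem bdryQ_apply {R : Type u} [Ring R] {n : ℕ} (x : Q R (n + 1)) :
    bdryQ R n x = ∑ i : Fin (n + 2), (-1 : ℤ) ^ (i : ℕ) • faceDiff R n i x := by
  simp [bdryQ]

theorem faceDiff_faceDiff {R : Type u} [Ring R] {n : ℕ} {i j : Fin (n + 2)} (h : i ≤ j)
    (x : Q R (n + 2)) :
    faceDiff R n i (faceDiff R (n + 1) j.succ x) =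
      faceDiff R n j (faceDiff R (n + 1) i.castSucc x) := by
  have : (faceDiff R n i).comp (faceDiff R (n + 1) j.succ) =
      (faceDiff R n j).comp (faceDiff R (n + 1) i.castSucc) := by
    ext p
    simp only [AddMonoidHom.comp_apply, faceDiff_of, map_sub, faceN_faceN h, faceN_faceE h,
      faceE_faceN h, faceE_faceE h]
    abel
  exact DFunLike.congr_fun this x

theorem bdryQ_bdryQ {R : Type u} [Ring R] (n : ℕ) (x : Q R (n + 2)) :
    bdryQ R n (bdryQ R (n + 1) x) = 0 := by
  rw [bdryQ_apply (bdryQ R (n + 1) x), bdryQ_apply x]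
  simp only [map_sum, map_zsmul, Finset.smul_sum]
  rw [← Finset.sum_product']
  let P := Fin (n + 2) × Fin (n + 3)
  let S : Finset P := {ij : P | (ij.2 : ℕ) ≤ (ij.1 : ℕ)}
  rw [Finset.univ_product_univ, ← Finset.sum_add_sum_compl S, ← eq_neg_iff_add_eq_zero,
    ← Finset.sum_neg_distrib]
  let φ : ∀ ij : P, ij ∈ S → P := fun ij hij =>
    (Fin.castLT ij.2 (lt_of_le_of_lt (Finset.mem_filter.mp hij).right (Fin.is_lt ij.1)), ij.1.succ)
  apply Finset.sum_bij φ
  · intro ij hij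
    simp_rw [S, φ, Finset.compl_filter, Finset.mem_filter_univ, Fin.val_succ,
      Fin.val_castLT] at hij ⊢
    omega
  · rintro ⟨i, j⟩ hij ⟨i', j'⟩ hij' h
    rw [Prod.mk_inj]
    exact ⟨by simpa [φ] using! congr_arg Prod.snd h,
      by simpa [φ, Fin.castSucc_castLT] using! congr_arg Fin.castSucc (congr_arg Prod.fst h)⟩
  · rintro ⟨i', j'⟩ hij'
    simp_rw [S, Finset.compl_filter, Finset.mem_filter_univ, not_le] at hij'
    refine ⟨(j'.pred <| ?_, Fin.castSucc i'), ?_, ?_⟩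
    · rintro rfl
      simp only [Fin.val_zero, not_lt_zero] at hij'
    · simpa [S] using! Nat.le_sub_one_of_lt hij'
    · simp only [φ, Fin.castLT_castSucc, Fin.succ_pred]
  · rintro ⟨i, j⟩ hij
    have hle : (j : ℕ) ≤ (i : ℕ) := by simpa [S] using! hij
    have key := faceDiff_faceDiff (n := n)
      (i := Fin.castLT j (lt_of_le_of_lt hle (Fin.is_lt i))) (j := i) hle x
    rw [Fin.castSucc_castLT] at key
    simp only [φ, Fin.val_succ, Fin.val_castLT, key, smul_smul, ← neg_smul]
    congr 1
    ring

theorem augQ_bdryQ {R : Type u} [Ring R] (x : Q R 1) : augQ R (bdryQ R 0 x) = 0 := by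
  have : (augQ R).comp (bdryQ R 0) = 0 := by
    ext p
    simp [bdryQ_apply, faceDiff_of, augQ]
  exact DFunLike.congr_fun this x

/-- An `(n+1)`-ary matrix pair, `n > 0`, is degenerate if `E_i` and `N_i` agree on it
for some `i`. -/
def IsDegenerate {R : Type u} [Ring R] {n : ℕ} (p : MatrixPair R (n + 2)) : Prop :=
  ∃ i : Fin (n + 2), faceE i p = faceN i p

/-- `M_n(R) ⊆ Q_n(R)`: the subgroup generated by the degenerate matrix pairs if `n > 0`, and zero
if `n = 0`. -/
def M (R : Type u) [Ring R] : (n : ℕ) → AddSubgroup (Q R n)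
  | 0 => ⊥
  | _ + 1 => AddSubgroup.closure {x | ∃ p, IsDegenerate p ∧ x = FreeAbelianGroup.of p}

theorem PrePair.bot_le_top {R : Type u} [Ring R] {n : ℕ} (i : Fin (n + 1))
    (p : PrePair R (n + 1)) : p.bot i ≤ p.top i := by
  obtain ⟨m, k, B, A⟩ := p
  refine PrePair.mk_le_mk.2 ⟨1, fun j => ?_, fun j => ⟨0, fun x => by simp [Matrix.one_apply]⟩⟩
  exact ⟨Fin.snoc (α := fun _ => R) (Pi.single j 1) 0, fun x => by
    simp [Fin.sum_univ_castSucc, Pi.single_apply, Matrix.one_apply]⟩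

theorem PrePair.top_le_bot_swap {R : Type u} [Ring R] (i j : Fin 2) (hij : j ≠ i)
    (p : PrePair R 2) (h : p.top i ≤ p.bot i) : p.top j ≤ p.bot j := by
  have si : ∀ x, i.succAbove x = j := by clear h; revert i j; decide
  have sj : ∀ x, j.succAbove x = i := by clear h si; revert i j; decide
  obtain ⟨m, k, B, A⟩ := p
  obtain ⟨U, h1, h2⟩ := PrePair.mk_le_mk.1 h
  refine PrePair.mk_le_mk.2 ⟨1 - U, fun l => ?_, fun l => ?_⟩
  · refine Fin.lastCases ?_ (fun l => ?_) l
    · obtain ⟨v, hv⟩ := h2 0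
      simp only [Matrix.submatrix_apply, id, si] at hv
      exact ⟨-v, fun x => by
        simp [sub_mul, Finset.sum_sub_distrib, Matrix.one_apply, hv x]⟩
    · obtain ⟨w, hw⟩ := h1 l.castSucc
      simp only [Matrix.of_apply, Fin.snoc_castSucc] at hw
      exact ⟨Pi.single l 1 - w, fun x => by
        simp [sub_mul, mul_sub, Finset.sum_sub_distrib, Matrix.one_apply, hw x, Pi.single_apply]⟩
  · obtain ⟨w, hw⟩ := h1 (Fin.last _)
    simp only [Matrix.of_apply, Fin.snoc_last] at hw
    exact ⟨-w, fun x => by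
      simp [sub_mul, Finset.sum_sub_distrib, Matrix.one_apply, hw x, sj]
      exact sub_eq_add_neg _ _⟩

theorem faces_eq_swap {R : Type u} [Ring R] (i j : Fin 2) (hij : j ≠ i) (p : MatrixPair R 2)
    (h : faceE i p = faceN i p) : faceE j p = faceN j p := by
  induction p using Quotient.inductionOn with | _ p
  have h' : AntisymmRel (· ≤ ·) (p.top i) (p.bot i) :=
    Quotient.exact (s := AntisymmRel.setoid _ _) h
  exact Quotient.sound (s := AntisymmRel.setoid _ _)
    ⟨PrePair.top_le_bot_swap i j hij p h'.1, PrePair.bot_le_top j p⟩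

theorem isDegenerate_face {R : Type u} [Ring R] {n : ℕ} {i j : Fin (n + 3)} (hij : i ≠ j)
    (p : MatrixPair R (n + 3)) (h : faceE j p = faceN j p) :
    IsDegenerate (faceE i p) ∧ IsDegenerate (faceN i p) := by
  rcases lt_or_gt_of_ne hij with hlt | hlt
  · obtain ⟨j, rfl⟩ := Fin.exists_succ_eq.2 (Fin.ne_zero_of_lt hlt)
    obtain ⟨i, rfl⟩ := Fin.exists_castSucc_eq.2 (Fin.ne_last_of_lt hlt)
    have hle : i ≤ j := Fin.castSucc_lt_succ_iff.1 hlt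
    refine ⟨⟨j, ?_⟩, ⟨j, ?_⟩⟩
    · rw [← faceE_faceE hle, h, faceE_faceN hle]
    · rw [← faceN_faceE hle, h, faceN_faceN hle]
  · obtain ⟨i, rfl⟩ := Fin.exists_succ_eq.2 (Fin.ne_zero_of_lt hlt)
    obtain ⟨j, rfl⟩ := Fin.exists_castSucc_eq.2 (Fin.ne_last_of_lt hlt)
    have hle : j ≤ i := Fin.castSucc_lt_succ_iff.1 hlt
    refine ⟨⟨j, ?_⟩, ⟨j, ?_⟩⟩
    · rw [faceE_faceE hle, h, ← faceN_faceE hle]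
    · rw [faceE_faceN hle, h, ← faceN_faceN hle]

/-- The degenerate matrix pairs generate a subcomplex. -/
theorem M_le_comap {R : Type u} [Ring R] (n : ℕ) :
    M R (n + 1) ≤ (M R n).comap (bdryQ R n) := by
  refine (AddSubgroup.closure_le _).2 ?_
  rintro _ ⟨p, ⟨j, hj⟩, rfl⟩
  simp only [AddSubgroup.coe_comap, Set.mem_preimage, SetLike.mem_coe, bdryQ_apply]
  refine AddSubgroup.sum_mem _ fun i _ => AddSubgroup.zsmul_mem _ ?_ _
  rw [faceDiff_of]
  by_cases hij : i = j
  · rw [hij, hj, sub_self]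
    exact zero_mem _
  · cases n with
    | zero =>
      rw [faces_eq_swap j i hij p hj, sub_self]
      exact zero_mem _
    | succ n =>
      have := isDegenerate_face hij p hj
      exact sub_mem (AddSubgroup.subset_closure ⟨_, this.1, rfl⟩)
        (AddSubgroup.subset_closure ⟨_, this.2, rfl⟩)

/-- The chain group `C_n(R) = Q_n(R) / M_n(R)`, `n ≥ 0`, of the complex of nondegenerate matrix
pairs. -/
abbrev C (R : Type u) [Ring R] (n : ℕ) : Type u := Q R n ⧸ M R n

/-- The chain in `C_n(R)` given by an `(n+1)`-ary matrix pair. -/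
def chain {R : Type u} [Ring R] {n : ℕ} (p : MatrixPair R (n + 1)) : C R n :=
  QuotientAddGroup.mk' (M R n) (FreeAbelianGroup.of p)

/-- The boundary map `∂_{n+1} : C_{n+1}(R) → C_n(R)`. -/
def bdry (R : Type u) [Ring R] (n : ℕ) : C R (n + 1) →+ C R n :=
  QuotientAddGroup.map (M R (n + 1)) (M R n) (bdryQ R n) (M_le_comap n)

/-- The augmentation `∂_0 : C_0(R) → C_{-1}(R) = ℤ`. -/
def aug (R : Type u) [Ring R] : C R 0 →+ ℤ :=
  QuotientAddGroup.lift (M R 0) (augQ R) (bot_le : (⊥ : AddSubgroup (Q R 0)) ≤ _)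

/-- The group `Z_n(R) ⊆ C_n(R)` of `n`-cycles, the kernel of `∂_n`. -/
def cycles (R : Type u) [Ring R] : (n : ℕ) → AddSubgroup (C R n)
  | 0 => (aug R).ker
  | n + 1 => (bdry R n).ker

/-- The group `B_n(R) ⊆ C_n(R)` of `n`-boundaries, the image of `∂_{n+1}`. -/
def boundaries (R : Type u) [Ring R] (n : ℕ) : AddSubgroup (C R n) := (bdry R n).range

theorem boundaries_le_cycles (R : Type u) [Ring R] (n : ℕ) :
    boundaries R n ≤ cycles R n := by
  rintro _ ⟨x, rfl⟩
  obtain ⟨x, rfl⟩ := QuotientAddGroup.mk_surjective x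
  cases n with
  | zero => exact augQ_bdryQ x
  | succ n =>
    change ((bdryQ R n (bdryQ R (n + 1) x) : Q R n) : C R n) = 0
    rw [bdryQ_bdryQ]
    rfl

/-- The `n`-dimensional homology `H_n(R) = Z_n(R) / B_n(R)` of the ring `R`. -/
abbrev H (R : Type u) [Ring R] (n : ℕ) : Type u :=
  cycles R n ⧸ (boundaries R n).addSubgroupOf (cycles R n)

/-- The homology class of a cycle. -/
def homologyClass {R : Type u} [Ring R] {n : ℕ} (z : cycles R n) : H R n :=
  QuotientAddGroup.mk' ((boundaries R n).addSubgroupOf (cycles R n)) z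

/-- The relators `[1,r] - [1,s] - [1,r s⁻¹]` (for `r, s ∈ kˣ`) and `[1,-1]` in the free abelian group
on symbols `[1,r]`, `r ∈ kˣ`. -/
def relators (k : Type u) [DivisionRing k] : Set (FreeAbelianGroup kˣ) :=
  {x | ∃ r s : kˣ, x = FreeAbelianGroup.of r - FreeAbelianGroup.of s -
      FreeAbelianGroup.of (r * s⁻¹)} ∪ {FreeAbelianGroup.of (-1)}

/-- The abelian group generated by the symbols `[1,r]`, `r ∈ kˣ`, modulo the relators. -/
abbrev Presented (k : Type u) [DivisionRing k] : Type u :=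
  FreeAbelianGroup kˣ ⧸ AddSubgroup.closure (relators k)

/-- The subgroup `{±1}` (the image of `{1, -1} ⊆ kˣ`) of the abelianization of `kˣ`. -/
def plusMinusOne (k : Type u) [DivisionRing k] : Subgroup (Abelianization kˣ) :=
  (Subgroup.zpowers (-1 : kˣ)).map Abelianization.of

end LinAlgRing

/-!
A pair `(B | A)` over `R` is the formula `∃ y, B y = A x`, and its solution set is a right
subspace of `R^n`. Over a division ring `k` the solution set determines the matrix pair
(`MatrixPair.sol_injective`), since linear maps can be extended from subspaces. In this way
`L_n(k)` becomes a lattice of subspaces of `k^n`: the face `E_i` is the projection along the `i`-th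
coordinate axis, the face `N_i` is the section by the `i`-th coordinate hyperplane, and a subspace
is degenerate when it contains a coordinate axis or lies in a coordinate hyperplane
(`isDegenerate_iff`).

The nondegenerate subspaces of `k^2` are therefore the lines `x + r y = 0` with `r ≠ 0`, which are
the matrix pairs `[1, r]`. They are cycles, so `H_1(k)` is the free abelian group on `kˣ` modulo
the boundaries of the nondegenerate subspaces of `k^3`. These are of two kinds
(`isDegenerate_or_plane_or_line`). For the plane `x + s y + t z = 0` the projections are
degenerate, and the sections give the relation `[1, t] = [1, s] + [1, s⁻¹ t]`
(`bdry_chain_plane`). For the line spanned by `(1, s, t)` the sections are degenerate, and the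
projections give the relation `[1, -s t⁻¹] - [1, -t⁻¹] + [1, -s⁻¹] = 0` (`bdry_chain_line`). The
planes make `r ↦ [1, r]` a homomorphism from `kˣ`. The line spanned by `(1, 1, -1)` gives
`[1, -1] = 0`, and the relations of all other lines then follow.

Hence the presented group maps onto `H_1(k)` (`presentedToHomology_surjective`). In the opposite
direction, sending `[1, r]` to the class of `r` and every other binary matrix pair to zero respects
both kinds of relation (`chainInvariant_bdry`), so it induces a homomorphism from `H_1(k)` to
`(kˣ)_ab / {±1}`, and the latter maps back to the presented group. The composite around this
triangle is the identity (`unitClassesToPresented_homologyInvariant`). As the maps onto `H_1(k)` and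
onto `(kˣ)_ab / {±1}` are surjective, both are isomorphisms.
-/

namespace LinAlgRing

universe u

/-! ### Solution sets of matrix pairs -/

section Solutions

variable {R : Type u} [Ring R] {n : ℕ}

/-- The solution set `{x | ∃ y, B y = A x}` of a pair `(B | A)`, as a right subspace of `R^n`. -/
def PrePair.sol (p : PrePair R n) : Submodule Rᵐᵒᵖ (Fin n → R) :=
  (LinearMap.range (Matrix.mulVecBilin R Rᵐᵒᵖ p.B)).comap (Matrix.mulVecBilin R Rᵐᵒᵖ p.A)

theorem PrePair.mem_sol {p : PrePair R n} {x : Fin n → R} :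
    x ∈ p.sol ↔ ∃ y, p.B.mulVec y = p.A.mulVec x := Iff.rfl

theorem PrePair.sol_mono : Monotone (PrePair.sol : PrePair R n → _) := by
  rintro p q ⟨U, V, G, h1, h2⟩ x ⟨y, hy⟩
  refine ⟨V.mulVec y - G.mulVec x, ?_⟩
  have h3 : q.B.mulVec (V.mulVec y) = q.A.mulVec x + q.B.mulVec (G.mulVec x) := by
    rw [Matrix.mulVec_mulVec, ← h1, ← Matrix.mulVec_mulVec, Matrix.mulVec_mulVec x q.B,
      ← Matrix.add_mulVec, ← h2, ← Matrix.mulVec_mulVec]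
    exact congrArg U.mulVec hy
  change q.B.mulVec _ = q.A.mulVec x
  rw [Matrix.mulVec_sub, h3, add_sub_cancel_right]

/-- The solution set of a matrix pair. -/
def MatrixPair.sol (p : MatrixPair R n) : Submodule Rᵐᵒᵖ (Fin n → R) :=
  Quotient.lift (s := AntisymmRel.setoid _ _) PrePair.sol
    (fun _ _ h => le_antisymm (PrePair.sol_mono h.1) (PrePair.sol_mono h.2)) p

theorem mem_sol_system {m : ℕ} {A : Matrix (Fin m) (Fin n) R} {x : Fin n → R} :
    x ∈ MatrixPair.sol (system A) ↔ A.mulVec x = 0 := by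
  change (∃ y, Matrix.mulVec 0 y = A.mulVec x) ↔ _
  simp [eq_comm]

theorem PrePair.mulVec_insertNth (p : PrePair R (n + 1)) (i : Fin (n + 1)) (c : R)
    (x : Fin n → R) : p.A.mulVec (i.insertNth c x : Fin (n + 1) → R) =
      (fun a => p.A a i * c) + (p.A.submatrix id i.succAbove).mulVec x := by
  ext a
  simp [Matrix.mulVec, dotProduct, Fin.sum_univ_succAbove _ i]

/-- A bottom face corresponds to the section of the solution set by a coordinate hyperplane. -/
theorem mem_sol_faceN {i : Fin (n + 1)} {p : MatrixPair R (n + 1)} {x : Fin n → R} :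
    x ∈ MatrixPair.sol (faceN i p) ↔ (i.insertNth 0 x : Fin (n + 1) → R) ∈ MatrixPair.sol p := by
  induction p using Quotient.inductionOn with | _ p
  change (∃ y, p.B.mulVec y = (p.A.submatrix id i.succAbove).mulVec x) ↔
    ∃ y, p.B.mulVec y = p.A.mulVec _
  rw [p.mulVec_insertNth]
  simp only [mul_zero]
  exact exists_congr fun y => by rw [← Pi.zero_def, zero_add]

/-- A top face corresponds to the projection of the solution set along a coordinate axis. -/
theorem mem_sol_faceE {i : Fin (n + 1)} {p : MatrixPair R (n + 1)} {x : Fin n → R} :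
    x ∈ MatrixPair.sol (faceE i p) ↔
      ∃ c, (i.insertNth c x : Fin (n + 1) → R) ∈ MatrixPair.sol p := by
  induction p using Quotient.inductionOn with | _ p
  have key : ∀ (y : Fin p.cols → R) (c : R), (p.top i).B.mulVec (Fin.snoc (α := fun _ => R) y c) =
      p.B.mulVec y + fun a => p.A a i * c := by
    intro y c
    funext (a : Fin p.rows)
    change ∑ z : Fin (p.cols + 1), Fin.snoc (α := fun _ => R) (p.B a) (p.A a i) z *
      Fin.snoc (α := fun _ => R) y c z = ∑ z, p.B a z * y z + p.A a i * c
    simp [Fin.sum_univ_castSucc]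
  change (∃ y, (p.top i).B.mulVec y = (p.A.submatrix id i.succAbove).mulVec x) ↔
    ∃ c y, p.B.mulVec y = p.A.mulVec _
  simp only [p.mulVec_insertNth]
  constructor
  · rintro ⟨y, hy⟩
    rw [← Fin.snoc_init_self (α := fun _ => R) y, key] at hy
    refine ⟨-(y (Fin.last _)), Fin.init (α := fun _ => R) y, ?_⟩
    rw [← hy]
    ext a
    simp
  · rintro ⟨c, y, hy⟩
    refine ⟨Fin.snoc (α := fun _ => R) y (-c), ?_⟩
    rw [key, hy]
    ext a
    simp

end Solutions

/-! ### Matrix pairs over a division ring -/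

section DivisionRing

variable {k : Type u} [DivisionRing k] {n : ℕ}

/-- Over a division ring a pair lies below another one as soon as its solution set does: the
matrix `A'` induces a map on `k^n` modulo the solution set of `(B | A)`, and this extends along the
embedding that `A` induces into the cokernel of `B`. -/
theorem PrePair.le_of_sol_le {p q : PrePair k n} (h : p.sol ≤ q.sol) : p ≤ q := by
  obtain ⟨pr, pc, pB, pA⟩ := p
  obtain ⟨qr, qc, qB, qA⟩ := q
  let I := LinearMap.range (Matrix.mulVecBilin k kᵐᵒᵖ pB)
  let J := LinearMap.range (Matrix.mulVecBilin k kᵐᵒᵖ qB)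
  let S : Submodule kᵐᵒᵖ (Fin n → k) := I.comap (Matrix.mulVecBilin k kᵐᵒᵖ pA)
  let f := S.mapQ I (Matrix.mulVecBilin k kᵐᵒᵖ pA) le_rfl
  let f' := S.mapQ J (Matrix.mulVecBilin k kᵐᵒᵖ qA) h
  have hf : LinearMap.ker f = ⊥ := by
    refine LinearMap.ker_eq_bot'.2 fun x hx => ?_
    obtain ⟨x, rfl⟩ := S.mkQ_surjective x
    exact (Submodule.Quotient.mk_eq_zero S).2 ((Submodule.Quotient.mk_eq_zero I).1 hx)
  obtain ⟨g, hg⟩ := f.exists_leftInverse_of_injective hf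
  let W := (f'.comp g).comp I.mkQ
  choose u hu using fun z => J.mkQ_surjective (W (Pi.single z 1))
  let U : Matrix (Fin qr) (Fin pr) k := Matrix.of fun x z => u z x
  have hU : ∀ v, J.mkQ (U.mulVec v) = W v := by
    intro v
    have : J.mkQ.comp (Matrix.mulVecBilin k kᵐᵒᵖ U) = W := by
      refine LinearMap.pi_ext fun z c => ?_
      have e : (Pi.single z c : Fin pr → k) = MulOpposite.op c • (Pi.single z 1) := by
        rw [← Pi.single_smul]; simp
      have e' : U.mulVec (Pi.single z 1) = u z := by
        ext x
        simp [U]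
      rw [e, map_smul, map_smul, ← hu]
      exact congrArg (fun v => MulOpposite.op c • J.mkQ v) e'
    exact LinearMap.congr_fun this v
  refine PrePair.mk_le_mk.2 ⟨U, fun j => ?_, fun j => ?_⟩
  · have h0 : W (fun z => pB z j) = 0 := by
      have : I.mkQ (fun z => pB z j) = 0 := by
        refine (Submodule.Quotient.mk_eq_zero I).2 ⟨Pi.single j 1, ?_⟩
        ext z
        simp
      simp only [W, LinearMap.comp_apply, this, map_zero]
    rw [← hU] at h0
    obtain ⟨v, hv⟩ := (Submodule.Quotient.mk_eq_zero J).1 h0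
    exact ⟨v, fun x => (congrFun hv x).symm⟩
  · have h0 : W (fun z => pA z j) = J.mkQ (fun x => qA x j) := by
      have e : I.mkQ (fun z => pA z j) = f (S.mkQ (Pi.single j 1)) := by
        refine congrArg I.mkQ ?_
        ext z
        simp
      have e' : J.mkQ (fun z => qA z j) = f' (S.mkQ (Pi.single j 1)) := by
        refine congrArg J.mkQ ?_
        ext z
        simp
      simp only [W, LinearMap.comp_apply, e, e']
      exact congrArg f' (LinearMap.congr_fun hg _)
    rw [← hU] at h0
    obtain ⟨v, hv⟩ := (Submodule.Quotient.eq J).1 h0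
    refine ⟨v, fun x => ?_⟩
    have := congrFun hv x
    exact (eq_add_of_sub_eq' this.symm)

/-- Over a division ring a matrix pair is determined by its solution set. -/
theorem MatrixPair.sol_injective :
    Function.Injective (MatrixPair.sol : MatrixPair k n → _) := by
  intro p q h
  induction p using Quotient.inductionOn with | _ p
  induction q using Quotient.inductionOn with | _ q
  exact Quotient.sound (s := AntisymmRel.setoid _ _)
    ⟨PrePair.le_of_sol_le (le_of_eq h), PrePair.le_of_sol_le (ge_of_eq h)⟩

/-- A matrix pair over a division ring is degenerate exactly when its solution set contains a
coordinate axis or lies in a coordinate hyperplane. -/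
theorem isDegenerate_iff {p : MatrixPair k (n + 2)} :
    IsDegenerate p ↔ ∃ i, Pi.single i 1 ∈ MatrixPair.sol p ∨ ∀ x ∈ MatrixPair.sol p, x i = 0 := by
  refine exists_congr fun i => ?_
  constructor
  · intro h
    by_contra! hc
    obtain ⟨hs, x, hx, hxi⟩ := hc
    have h1 : i.removeNth x ∈ MatrixPair.sol (faceE i p) :=
      mem_sol_faceE.2 ⟨x i, by rwa [Fin.insertNth_self_removeNth]⟩
    rw [h, mem_sol_faceN] at h1
    refine hs ?_
    have h2 := (MatrixPair.sol p).smul_mem (MulOpposite.op (x i)⁻¹)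
      ((MatrixPair.sol p).sub_mem hx h1)
    convert h2 using 1
    ext j
    refine Fin.succAboveCases i ?_ (fun j => ?_) j
    · simp [hxi]
    · simp
  · intro h
    refine MatrixPair.sol_injective (le_antisymm (fun x hx => ?_) fun x hx =>
      mem_sol_faceE.2 ⟨0, mem_sol_faceN.1 hx⟩)
    obtain ⟨c, hc⟩ := mem_sol_faceE.1 hx
    rw [mem_sol_faceN]
    rcases h with h | h
    · have h2 := (MatrixPair.sol p).sub_mem hc
        ((MatrixPair.sol p).smul_mem (MulOpposite.op c) h)
      convert h2 using 1
      ext j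
      refine Fin.succAboveCases i ?_ (fun j => ?_) j <;> simp
    · have := h _ hc
      rw [Fin.insertNth_apply_same] at this
      rwa [this] at hc

end DivisionRing

/-! ### Faces in low dimension and boundaries of matrix pairs -/

section LowDimension

variable {R : Type u} [Ring R] {p : MatrixPair R 2} {q : MatrixPair R 3} {a b : R}

theorem mem_sol_faceN_zero :
    ![a, b] ∈ MatrixPair.sol (faceN 0 q) ↔ ![0, a, b] ∈ MatrixPair.sol q := by
  rw [mem_sol_faceN, show ((0 : Fin 3).insertNth 0 ![a, b] : Fin 3 → R) = ![0, a, b] by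
    ext i; fin_cases i <;> rfl]

theorem mem_sol_faceN_one :
    ![a, b] ∈ MatrixPair.sol (faceN 1 q) ↔ ![a, 0, b] ∈ MatrixPair.sol q := by
  rw [mem_sol_faceN, show ((1 : Fin 3).insertNth 0 ![a, b] : Fin 3 → R) = ![a, 0, b] by
    ext i; fin_cases i <;> rfl]

theorem mem_sol_faceN_two :
    ![a, b] ∈ MatrixPair.sol (faceN 2 q) ↔ ![a, b, 0] ∈ MatrixPair.sol q := by
  rw [mem_sol_faceN, show ((2 : Fin 3).insertNth 0 ![a, b] : Fin 3 → R) = ![a, b, 0] by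
    ext i; fin_cases i <;> rfl]

theorem mem_sol_faceE_zero :
    ![a, b] ∈ MatrixPair.sol (faceE 0 q) ↔ ∃ c, ![c, a, b] ∈ MatrixPair.sol q := by
  rw [mem_sol_faceE]
  refine exists_congr fun c => ?_
  rw [show ((0 : Fin 3).insertNth c ![a, b] : Fin 3 → R) = ![c, a, b] by
    ext i; fin_cases i <;> rfl]

theorem mem_sol_faceE_one :
    ![a, b] ∈ MatrixPair.sol (faceE 1 q) ↔ ∃ c, ![a, c, b] ∈ MatrixPair.sol q := by
  rw [mem_sol_faceE]
  refine exists_congr fun c => ?_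
  rw [show ((1 : Fin 3).insertNth c ![a, b] : Fin 3 → R) = ![a, c, b] by
    ext i; fin_cases i <;> rfl]

theorem mem_sol_faceE_two :
    ![a, b] ∈ MatrixPair.sol (faceE 2 q) ↔ ∃ c, ![a, b, c] ∈ MatrixPair.sol q := by
  rw [mem_sol_faceE]
  refine exists_congr fun c => ?_
  rw [show ((2 : Fin 3).insertNth c ![a, b] : Fin 3 → R) = ![a, b, c] by
    ext i; fin_cases i <;> rfl]

theorem mem_sol_one_row {r : R} :
    ![a, b] ∈ MatrixPair.sol (system !![1, r]) ↔ a + r * b = 0 := by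
  rw [mem_sol_system]
  simp

theorem chain_of_isDegenerate {n : ℕ} {p : MatrixPair R (n + 2)} (h : IsDegenerate p) :
    chain p = 0 :=
  (QuotientAddGroup.eq_zero_iff _).2 (AddSubgroup.subset_closure ⟨p, h, rfl⟩)

theorem bdry_chain {n : ℕ} (p : MatrixPair R (n + 2)) :
    bdry R n (chain p) = ∑ i : Fin (n + 2), (-1 : ℤ) ^ (i : ℕ) •
      (chain (faceE i p) - chain (faceN i p)) := by
  change QuotientAddGroup.mk' (M R n) (bdryQ R n (FreeAbelianGroup.of p)) = _
  simp only [bdryQ_apply, map_sum, map_zsmul, faceDiff_of, map_sub]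
  rfl

theorem bdry_one_chain (q : MatrixPair R 3) :
    bdry R 1 (chain q) = chain (faceE 0 q) - chain (faceN 0 q) -
      (chain (faceE 1 q) - chain (faceN 1 q)) + (chain (faceE 2 q) - chain (faceN 2 q)) := by
  rw [bdry_chain, Fin.sum_univ_three]
  simp
  abel

end LowDimension

/-! ### Classification of nondegenerate binary and ternary matrix pairs -/

section Classes

variable {k : Type u} [DivisionRing k]

theorem MatrixPair.ext_two {p q : MatrixPair k 2}
    (h : ∀ a b, ![a, b] ∈ MatrixPair.sol p ↔ ![a, b] ∈ MatrixPair.sol q) : p = q := by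
  refine MatrixPair.sol_injective (SetLike.ext fun x => ?_)
  rw [show x = ![x 0, x 1] by ext i; fin_cases i <;> rfl]
  exact h _ _

theorem isDegenerate_of_snd_eq_zero {p : MatrixPair k 2}
    (h : ∀ a b, ![a, b] ∈ MatrixPair.sol p → b = 0) : IsDegenerate p := by
  refine isDegenerate_iff.2 ⟨1, Or.inr fun x hx => ?_⟩
  rw [show x = ![x 0, x 1] by ext i; fin_cases i <;> rfl] at hx
  exact h _ _ hx

theorem isDegenerate_of_forall_mem_sol {p : MatrixPair k 2}
    (h : ∀ a b, ![a, b] ∈ MatrixPair.sol p) : IsDegenerate p :=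
  isDegenerate_iff.2 ⟨0, Or.inl (by convert h 1 0 using 1; ext i; fin_cases i <;> rfl)⟩

theorem not_isDegenerate_one_row (r : kˣ) : ¬ IsDegenerate (system !![1, (r : k)]) := by
  have e0 : (Pi.single 0 1 : Fin 2 → k) = ![1, 0] := by ext i; fin_cases i <;> rfl
  have e1 : (Pi.single 1 1 : Fin 2 → k) = ![0, 1] := by ext i; fin_cases i <;> rfl
  have hm : ![-(r : k), 1] ∈ MatrixPair.sol (system !![1, (r : k)]) := by
    rw [mem_sol_one_row]; simp
  rw [isDegenerate_iff, Fin.exists_fin_two, e0, e1, mem_sol_one_row, mem_sol_one_row]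
  rintro ((h | h) | (h | h))
  · simp at h
  · exact r.ne_zero (by simpa using h _ hm)
  · simp at h
  · exact one_ne_zero (h _ hm)

theorem one_row_injective :
    Function.Injective fun r : kˣ => system !![1, (r : k)] := by
  intro r s h
  have hm : ![-(r : k), 1] ∈ MatrixPair.sol (system !![1, (s : k)]) := by
    rw [← show system _ = system _ from h, mem_sol_one_row]; simp
  rw [mem_sol_one_row, mul_one] at hm
  exact Units.ext (neg_add_eq_zero.1 hm)

theorem exists_mem_apply_eq_one {n : ℕ} {S : Submodule kᵐᵒᵖ (Fin n → k)} {i : Fin n} {x : Fin n → k}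
    (hx : x ∈ S) (hi : x i ≠ 0) : ∃ y ∈ S, y i = 1 :=
  ⟨_, S.smul_mem (MulOpposite.op (x i)⁻¹) hx, by simp [hi]⟩

theorem eq_zero_of_single_mem {n : ℕ} {S : Submodule kᵐᵒᵖ (Fin n → k)} {i : Fin n}
    (hS : Pi.single i 1 ∉ S) {c : k} (hc : Pi.single i c ∈ S) : c = 0 := by
  by_contra h
  refine hS ?_
  have := S.smul_mem (MulOpposite.op c⁻¹) hc
  rwa [← Pi.single_smul, op_smul_eq_mul, mul_inv_cancel₀ h] at this

/-- A nondegenerate binary matrix pair is the line `x + r y = 0` for some `r ≠ 0`. -/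
theorem isDegenerate_or_eq_one_row (p : MatrixPair k 2) :
    IsDegenerate p ∨ ∃ r : kˣ, p = system !![1, (r : k)] := by
  refine or_iff_not_imp_left.2 fun h => ?_
  rw [isDegenerate_iff] at h
  push Not at h
  have h0 : ∀ c, ![c, 0] ∈ MatrixPair.sol p → c = 0 := fun c hc =>
    eq_zero_of_single_mem (h 0).1 (by convert hc using 1; ext i; fin_cases i <;> rfl)
  have h1 : ∀ c, ![0, c] ∈ MatrixPair.sol p → c = 0 := fun c hc =>
    eq_zero_of_single_mem (h 1).1 (by convert hc using 1; ext i; fin_cases i <;> rfl)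
  obtain ⟨x, hx, hx1⟩ := (h 1).2
  obtain ⟨y, hy, hy1⟩ := exists_mem_apply_eq_one hx hx1
  rw [show y = ![y 0, 1] by ext i; fin_cases i; rfl; exact hy1] at hy
  have hy0 : y 0 ≠ 0 := fun h' => one_ne_zero (h1 1 (h' ▸ hy))
  refine ⟨-Units.mk0 _ hy0, MatrixPair.ext_two fun a b => ?_⟩
  rw [mem_sol_one_row]
  have hb := (MatrixPair.sol p).smul_mem (MulOpposite.op b) hy
  simp only [Matrix.smul_cons, op_smul_eq_mul, one_mul, Matrix.smul_empty] at hb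
  constructor
  · intro hab
    have := h0 (a - y 0 * b) (by
      convert (MatrixPair.sol p).sub_mem hab hb using 1
      ext i
      fin_cases i <;> simp)
    simpa [sub_eq_add_neg] using this
  · intro hab
    have : a = y 0 * b := by simpa [← sub_eq_add_neg, sub_eq_zero] using hab
    rwa [this]

/-- The nondegenerate ternary matrix pairs are the lines and the planes in general position with
respect to the coordinate subspaces. -/
theorem isDegenerate_or_plane_or_line (q : MatrixPair k 3) : IsDegenerate q ∨
    (∃ s t : kˣ, ∀ x y z, ![x, y, z] ∈ MatrixPair.sol q ↔ x + s * y + t * z = 0) ∨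
    ∃ s t : kˣ, ∀ x y z, ![x, y, z] ∈ MatrixPair.sol q ↔ y = s * x ∧ z = t * x := by
  refine or_iff_not_imp_left.2 fun h => ?_
  rw [isDegenerate_iff] at h
  push Not at h
  have h0 : ∀ c, ![c, 0, 0] ∈ MatrixPair.sol q → c = 0 := fun c hc =>
    eq_zero_of_single_mem (h 0).1 (by convert hc using 1; ext i; fin_cases i <;> rfl)
  have h1 : ∀ c, ![0, c, 0] ∈ MatrixPair.sol q → c = 0 := fun c hc =>
    eq_zero_of_single_mem (h 1).1 (by convert hc using 1; ext i; fin_cases i <;> rfl)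
  have h2 : ∀ c, ![0, 0, c] ∈ MatrixPair.sol q → c = 0 := fun c hc =>
    eq_zero_of_single_mem (h 2).1 (by convert hc using 1; ext i; fin_cases i <;> rfl)
  have hE : ∀ x : Fin 3 → k, x = ![x 0, x 1, x 2] := fun x => by ext i; fin_cases i <;> rfl
  have hadd : ∀ {x y z x' y' z' : k}, ![x, y, z] ∈ MatrixPair.sol q →
      ![x', y', z'] ∈ MatrixPair.sol q → ∀ c, ![x + x' * c, y + y' * c, z + z' * c] ∈
        MatrixPair.sol q := fun h h' c => by
    simpa using (MatrixPair.sol q).add_mem h ((MatrixPair.sol q).smul_mem (MulOpposite.op c) h')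
  obtain ⟨v, hv, hv0⟩ := (h 0).2
  obtain ⟨w, hw, hw0⟩ := exists_mem_apply_eq_one hv hv0
  rw [hE w, hw0] at hw
  -- The two cases differ in whether the section by `x = 0` is a line or zero.
  by_cases hN : ∃ b, ![0, b, 1] ∈ MatrixPair.sol q
  · left
    obtain ⟨b, hb⟩ := hN
    have hb0 : b ≠ 0 := fun h' => one_ne_zero (h2 1 (h' ▸ hb))
    -- Correcting a vector outside `x = 0` by the section makes its last coordinate zero.
    obtain ⟨u, hu⟩ : ∃ u, ![1, u, 0] ∈ MatrixPair.sol q :=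
      ⟨_, by simpa using hadd hw hb (-(w 2))⟩
    have hu0 : u ≠ 0 := fun h' => one_ne_zero (h0 1 (h' ▸ hu))
    have key : ∀ x y z, ![x, y, z] ∈ MatrixPair.sol q ↔ y = u * x + b * z := by
      intro x y z
      constructor
      · intro hx
        have := h1 (y + u * (-x) + b * (-z)) (by simpa using hadd (hadd hx hu (-x)) hb (-z))
        rw [mul_neg, mul_neg, add_assoc, ← neg_add, ← sub_eq_add_neg, sub_eq_zero] at this
        exact this
      · rintro rfl
        have := hadd (hadd (zero_mem (MatrixPair.sol q) |> fun h => by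
          rwa [hE 0] at h) hu x) hb z
        simpa using this
    refine ⟨-(Units.mk0 u hu0)⁻¹, (Units.mk0 u hu0)⁻¹ * Units.mk0 b hb0, fun x y z => ?_⟩
    rw [key]
    have : x + ((-(Units.mk0 u hu0)⁻¹ : kˣ) : k) * y +
        (((Units.mk0 u hu0)⁻¹ * Units.mk0 b hb0 : kˣ) : k) * z =
        u⁻¹ * (u * x + b * z - y) := by
      simp [mul_add, mul_sub, hu0, mul_assoc]
      abel
    rw [this, mul_eq_zero, or_iff_right (inv_ne_zero hu0), sub_eq_zero, eq_comm]
  · right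
    -- A section that is nonzero would contain a vector whose last coordinate is `1`.
    have hsec : ∀ y z, ![0, y, z] ∈ MatrixPair.sol q → y = 0 ∧ z = 0 := by
      intro y z hyz
      have hz : z = 0 := by
        by_contra hz
        refine hN ⟨y * z⁻¹, ?_⟩
        simpa [hz] using (MatrixPair.sol q).smul_mem (MulOpposite.op z⁻¹) hyz
      subst hz
      exact ⟨h1 y hyz, rfl⟩
    have key : ∀ x y z, ![x, y, z] ∈ MatrixPair.sol q ↔ y = w 1 * x ∧ z = w 2 * x := by
      intro x y z
      constructor
      · intro hx
        have := hsec (y + w 1 * (-x)) (z + w 2 * (-x)) (by simpa using hadd hx hw (-x))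
        simpa [← sub_eq_add_neg, sub_eq_zero] using this
      · rintro ⟨rfl, rfl⟩
        simpa using (MatrixPair.sol q).smul_mem (MulOpposite.op x) hw
    have hne : w 1 ≠ 0 ∧ w 2 ≠ 0 := by
      constructor
      · obtain ⟨x, hx, hx1⟩ := (h 1).2
        rw [hE x, key] at hx
        exact left_ne_zero_of_mul (hx.1 ▸ hx1)
      · obtain ⟨x, hx, hx2⟩ := (h 2).2
        rw [hE x, key] at hx
        exact left_ne_zero_of_mul (hx.2 ▸ hx2)
    exact ⟨Units.mk0 _ hne.1, Units.mk0 _ hne.2, key⟩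

end Classes

/-! ### Boundaries of lines and planes, and relations in `H_1` -/

section Boundaries

variable {k : Type u} [DivisionRing k]

/-- The boundary of the plane `x + s y + t z = 0`: all its projections are degenerate. -/
theorem bdry_chain_plane {q : MatrixPair k 3} {s t : kˣ}
    (h : ∀ x y z, ![x, y, z] ∈ MatrixPair.sol q ↔ x + s * y + t * z = 0) :
    bdry k 1 (chain q) = chain (system !![1, (t : k)]) - chain (system !![1, (s : k)]) -
      chain (system !![1, ((s⁻¹ * t : kˣ) : k)]) := by
  have hE0 : IsDegenerate (faceE 0 q) := isDegenerate_of_forall_mem_sol fun a b =>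
    mem_sol_faceE_zero.2 ⟨-(s * a + t * b), by rw [h]; abel⟩
  have hE1 : IsDegenerate (faceE 1 q) := isDegenerate_of_forall_mem_sol fun a b =>
    mem_sol_faceE_one.2 ⟨-(s⁻¹ : kˣ) * (a + t * b), by
      rw [h, neg_mul, mul_neg, Units.mul_inv_cancel_left]; abel⟩
  have hE2 : IsDegenerate (faceE 2 q) := isDegenerate_of_forall_mem_sol fun a b =>
    mem_sol_faceE_two.2 ⟨-(t⁻¹ : kˣ) * (a + s * b), by
      rw [h, neg_mul, mul_neg, Units.mul_inv_cancel_left]; abel⟩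
  have hN0 : faceN 0 q = system !![1, ((s⁻¹ * t : kˣ) : k)] := MatrixPair.ext_two fun a b => by
    rw [mem_sol_faceN_zero, h, mem_sol_one_row, zero_add, ← Units.mul_right_eq_zero s⁻¹, mul_add,
      Units.inv_mul_cancel_left, Units.val_mul, mul_assoc]
  have hN1 : faceN 1 q = system !![1, (t : k)] := MatrixPair.ext_two fun a b => by
    rw [mem_sol_faceN_one, h, mem_sol_one_row, mul_zero, add_zero]
  have hN2 : faceN 2 q = system !![1, (s : k)] := MatrixPair.ext_two fun a b => by
    rw [mem_sol_faceN_two, h, mem_sol_one_row, mul_zero, add_zero]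
  rw [bdry_one_chain, chain_of_isDegenerate hE0, chain_of_isDegenerate hE1,
    chain_of_isDegenerate hE2, hN0, hN1, hN2]
  abel

/-- The boundary of the line spanned by `(1, s, t)`: all its coordinate sections are zero. -/
theorem bdry_chain_line {q : MatrixPair k 3} {s t : kˣ}
    (h : ∀ x y z, ![x, y, z] ∈ MatrixPair.sol q ↔ y = s * x ∧ z = t * x) :
    bdry k 1 (chain q) = chain (system !![1, ((-(s * t⁻¹) : kˣ) : k)]) -
      chain (system !![1, ((-t⁻¹ : kˣ) : k)]) + chain (system !![1, ((-s⁻¹ : kˣ) : k)]) := by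
  have hN0 : IsDegenerate (faceN 0 q) := isDegenerate_of_snd_eq_zero fun a b hab => by
    simpa using ((h _ _ _).1 (mem_sol_faceN_zero.1 hab)).2
  have hN1 : IsDegenerate (faceN 1 q) := isDegenerate_of_snd_eq_zero fun a b hab => by
    have := (h _ _ _).1 (mem_sol_faceN_one.1 hab)
    have ha : a = 0 := by simpa using this.1.symm
    simpa [ha] using this.2
  have hN2 : IsDegenerate (faceN 2 q) := isDegenerate_of_snd_eq_zero fun a b hab => by
    have := (h _ _ _).1 (mem_sol_faceN_two.1 hab)
    have ha : a = 0 := by simpa using this.2.symm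
    simpa [ha] using this.1
  have hE0 : faceE 0 q = system !![1, ((-(s * t⁻¹) : kˣ) : k)] :=
    MatrixPair.ext_two fun a b => by
      rw [mem_sol_faceE_zero, mem_sol_one_row]
      simp only [h, Units.val_neg, neg_mul, ← sub_eq_add_neg, sub_eq_zero]
      constructor
      · rintro ⟨c, rfl, rfl⟩
        simp [mul_assoc]
      · rintro rfl
        exact ⟨(t⁻¹ : kˣ) * b, by simp [mul_assoc], by simp⟩
  have hE1 : faceE 1 q = system !![1, ((-t⁻¹ : kˣ) : k)] := MatrixPair.ext_two fun a b => by
    rw [mem_sol_faceE_one, mem_sol_one_row]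
    simp only [h, exists_eq_left, Units.val_neg, neg_mul, ← sub_eq_add_neg, sub_eq_zero]
    rw [Units.eq_inv_mul_iff_mul_eq, eq_comm]
  have hE2 : faceE 2 q = system !![1, ((-s⁻¹ : kˣ) : k)] := MatrixPair.ext_two fun a b => by
    rw [mem_sol_faceE_two, mem_sol_one_row]
    simp only [h, exists_eq_right, Units.val_neg, neg_mul, ← sub_eq_add_neg, sub_eq_zero]
    rw [Units.eq_inv_mul_iff_mul_eq, eq_comm]
  rw [bdry_one_chain, chain_of_isDegenerate hN0, chain_of_isDegenerate hN1,
    chain_of_isDegenerate hN2, hE0, hE1, hE2]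
  abel

theorem chain_one_row_mem_cycles (r : kˣ) :
    chain (system !![1, (r : k)]) ∈ cycles k 1 := by
  change bdry k 0 _ = 0
  -- Both projections are the whole of `k`, both sections are zero.
  have hE : faceE 0 (system !![1, (r : k)]) = faceE 1 (system !![1, (r : k)]) := by
    refine MatrixPair.sol_injective (SetLike.ext fun x => ?_)
    rw [mem_sol_faceE, mem_sol_faceE]
    refine iff_of_true ⟨-(r * x 0), ?_⟩ ⟨-((r⁻¹ : kˣ) * x 0), ?_⟩
    · rw [show ((0 : Fin 2).insertNth _ x : Fin 2 → k) = ![-(r * x 0), x 0] by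
        ext i; fin_cases i <;> rfl, mem_sol_one_row]
      simp
    · rw [show ((1 : Fin 2).insertNth _ x : Fin 2 → k) = ![x 0, -((r⁻¹ : kˣ) * x 0)] by
        ext i; fin_cases i <;> rfl, mem_sol_one_row]
      simp
  have hN : faceN 0 (system !![1, (r : k)]) = faceN 1 (system !![1, (r : k)]) := by
    refine MatrixPair.sol_injective (SetLike.ext fun x => ?_)
    rw [mem_sol_faceN, mem_sol_faceN,
      show ((0 : Fin 2).insertNth 0 x : Fin 2 → k) = ![0, x 0] by ext i; fin_cases i <;> rfl,
      show ((1 : Fin 2).insertNth 0 x : Fin 2 → k) = ![x 0, 0] by ext i; fin_cases i <;> rfl,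
      mem_sol_one_row, mem_sol_one_row]
    simp
  rw [bdry_chain, Fin.sum_univ_two]
  simp [hE, hN]

/-- The cycle `[1, r]`. -/
def rowCycle (r : kˣ) : cycles k 1 :=
  ⟨chain (system !![1, (r : k)]), chain_one_row_mem_cycles r⟩

/-- The homology class of `[1, r]`. -/
def rowClass (r : kˣ) : H k 1 :=
  homologyClass (rowCycle r)

theorem homologyClass_eq_zero {n : ℕ} {z : cycles k n} (h : (z : C k n) ∈ boundaries k n) :
    homologyClass z = 0 :=
  (QuotientAddGroup.eq_zero_iff _).2 h

/-- The relation given by the boundary of the plane `x + s y + s r z = 0`. -/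
theorem rowClass_mul (s r : kˣ) : rowClass (s * r) = rowClass s + rowClass r := by
  have hq : ∀ x y z : k, ![x, y, z] ∈ MatrixPair.sol (system !![1, (s : k), ((s * r : kˣ) : k)]) ↔
      x + s * y + (s * r : kˣ) * z = 0 := fun x y z => by
    rw [mem_sol_system]
    simp [add_assoc]
  have hb := bdry_chain_plane hq
  rw [inv_mul_cancel_left] at hb
  have : homologyClass (rowCycle (s * r) - rowCycle s - rowCycle r) = 0 :=
    homologyClass_eq_zero ⟨_, hb⟩
  rw [homologyClass, map_sub, map_sub, sub_sub, sub_eq_zero] at this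
  exact this

theorem rowClass_neg_one : rowClass (-1 : kˣ) = 0 := by
  -- The line spanned by `(1, 1, -1)`.
  have hq : ∀ x y z : k, ![x, y, z] ∈ MatrixPair.sol (system !![1, -1, 0; 1, 0, 1]) ↔
      y = (1 : kˣ) * x ∧ z = (-1 : kˣ) * x := fun x y z => by
    rw [mem_sol_system]
    simp [← sub_eq_add_neg, sub_eq_zero, eq_neg_iff_add_eq_zero, add_comm, eq_comm]
  have hb := bdry_chain_line hq
  simp only [inv_neg, inv_one, one_mul, neg_neg, sub_self, zero_add] at hb
  exact homologyClass_eq_zero ⟨_, hb⟩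

end Boundaries

/-! ### The invariant of a one-dimensional homology class -/

section Invariant

variable (k : Type u) [DivisionRing k]

/-- The group `(kˣ)_ab / {±1}`, written additively. -/
abbrev UnitClasses : Type u := Additive (Abelianization kˣ ⧸ plusMinusOne k)

variable {k}

/-- The class of a unit in `(kˣ)_ab / {±1}`. -/
def unitClass (r : kˣ) : UnitClasses k := Additive.ofMul (QuotientGroup.mk (Abelianization.of r))

theorem unitClass_mul (r s : kˣ) : unitClass (r * s) = unitClass r + unitClass s := by
  simp only [unitClass, map_mul, QuotientGroup.mk_mul, ofMul_mul]

theorem unitClass_inv (r : kˣ) : unitClass r⁻¹ = -unitClass r := by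
  simp only [unitClass, map_inv, QuotientGroup.mk_inv, ofMul_inv]

theorem unitClass_neg_one : unitClass (-1 : kˣ) = 0 :=
  congrArg Additive.ofMul ((QuotientGroup.eq_one_iff _).2
    (Subgroup.mem_map_of_mem _ (Subgroup.mem_zpowers _)))

theorem unitClass_neg (r : kˣ) : unitClass (-r) = unitClass r := by
  rw [← neg_one_mul, unitClass_mul, unitClass_neg_one, zero_add]

open Classical in
/-- The invariant of a binary matrix pair in `(kˣ)_ab / {±1}`: the class of `r` for `[1, r]`, and
zero for the degenerate matrix pairs. -/
noncomputable def pairClass (p : MatrixPair k 2) : UnitClasses k :=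
  if h : ∃ r : kˣ, p = system !![1, (r : k)] then unitClass h.choose else 0

theorem pairClass_one_row (r : kˣ) : pairClass (system !![1, (r : k)]) = unitClass r := by
  have h : ∃ s : kˣ, system !![1, (r : k)] = system !![1, (s : k)] := ⟨r, rfl⟩
  rw [pairClass, dif_pos h]
  exact congrArg unitClass (one_row_injective h.choose_spec).symm

theorem pairClass_of_isDegenerate {p : MatrixPair k 2} (hp : IsDegenerate p) : pairClass p = 0 :=
  dif_neg (by rintro ⟨r, rfl⟩; exact not_isDegenerate_one_row r hp)

variable (k) in
/-- The extension of `pairClass` to the chain group `C_1(k)`. -/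
noncomputable def chainInvariant : C k 1 →+ UnitClasses k :=
  QuotientAddGroup.lift (M k 1) (FreeAbelianGroup.lift pairClass) <| by
    refine (AddSubgroup.closure_le _).2 ?_
    rintro _ ⟨p, hp, rfl⟩
    exact (FreeAbelianGroup.lift_apply_of _ _).trans (pairClass_of_isDegenerate hp)

theorem chainInvariant_one_row (r : kˣ) :
    chainInvariant k (chain (system !![1, (r : k)])) = unitClass r :=
  (FreeAbelianGroup.lift_apply_of _ _).trans (pairClass_one_row r)

theorem closure_range_chain {R : Type u} [Ring R] (n : ℕ) :
    AddSubgroup.closure (Set.range (chain : MatrixPair R (n + 1) → C R n)) = ⊤ := by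
  refine (AddSubgroup.eq_top_iff' _).2 fun x => ?_
  obtain ⟨x, rfl⟩ := QuotientAddGroup.mk'_surjective _ x
  induction x using FreeAbelianGroup.induction_on with
  | zero => rw [map_zero]; exact zero_mem _
  | of p => exact AddSubgroup.subset_closure ⟨p, rfl⟩
  | neg p h => rw [map_neg]; exact neg_mem h
  | add x y hx hy => rw [map_add]; exact add_mem hx hy

/-- The invariant vanishes on boundaries, by the description of the nondegenerate ternary matrix
pairs. -/
theorem chainInvariant_bdry (x : C k 2) : chainInvariant k (bdry k 1 x) = 0 := by
  have hx : x ∈ AddSubgroup.closure (Set.range (chain : MatrixPair k 3 → C k 2)) := by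
    rw [closure_range_chain]; trivial
  suffices h : AddSubgroup.closure (Set.range (chain : MatrixPair k 3 → C k 2)) ≤
      ((chainInvariant k).comp (bdry k 1)).ker from h hx
  refine (AddSubgroup.closure_le _).2 ?_
  rintro _ ⟨q, rfl⟩
  change chainInvariant k (bdry k 1 (chain q)) = 0
  obtain h | ⟨s, t, h⟩ | ⟨s, t, h⟩ := isDegenerate_or_plane_or_line q
  · rw [chain_of_isDegenerate h, map_zero, map_zero]
  · rw [bdry_chain_plane h]
    simp only [map_sub, chainInvariant_one_row, unitClass_mul, unitClass_inv]
    abel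
  · rw [bdry_chain_line h]
    simp only [map_sub, map_add, chainInvariant_one_row, unitClass_neg, unitClass_mul,
      unitClass_inv]
    abel

variable (k) in
/-- The homomorphism `H_1(k) → (kˣ)_ab / {±1}` induced by `pairClass`. -/
noncomputable def homologyInvariant : H k 1 →+ UnitClasses k :=
  QuotientAddGroup.lift _ ((chainInvariant k).comp (cycles k 1).subtype) <| by
    rintro ⟨_, hz⟩ ⟨x, rfl⟩
    exact chainInvariant_bdry x

theorem homologyInvariant_rowClass (r : kˣ) :
    homologyInvariant k (rowClass r) = unitClass r :=
  chainInvariant_one_row r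

end Invariant

/-! ### The presentation of `H_1` -/

section Presentation

variable (k : Type u) [DivisionRing k]

/-- The homomorphism from the presented group to `H_1(k)` given by the classes of `[1, r]`. -/
def presentedToHomology : Presented k →+ H k 1 :=
  QuotientAddGroup.lift _ (FreeAbelianGroup.lift rowClass) <| by
    refine (AddSubgroup.closure_le _).2 ?_
    rintro _ (⟨r, s, rfl⟩ | rfl)
    · have h := rowClass_mul (r * s⁻¹) s
      rw [inv_mul_cancel_right] at h
      simp [AddMonoidHom.mem_ker, h]
    · simp [AddMonoidHom.mem_ker, rowClass_neg_one]

variable {k}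

/-- The class of the symbol `[1, r]` in the presented group. -/
def symbolClass (r : kˣ) : Presented k := QuotientAddGroup.mk (FreeAbelianGroup.of r)

theorem presentedToHomology_symbolClass (r : kˣ) :
    presentedToHomology k (symbolClass r) = rowClass r :=
  FreeAbelianGroup.lift_apply_of _ _

theorem symbolClass_mul (r s : kˣ) : symbolClass (r * s) = symbolClass r + symbolClass s := by
  have h : ((FreeAbelianGroup.of (r * s) - FreeAbelianGroup.of s -
      FreeAbelianGroup.of (r * s * s⁻¹) : FreeAbelianGroup kˣ) : Presented k) = 0 :=
    (QuotientAddGroup.eq_zero_iff _).2 (AddSubgroup.subset_closure (Or.inl ⟨_, _, rfl⟩))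
  rw [mul_inv_cancel_right, sub_sub, QuotientAddGroup.mk_sub, sub_eq_zero, add_comm] at h
  exact h

theorem symbolClass_neg_one : symbolClass (-1 : kˣ) = 0 :=
  (QuotientAddGroup.eq_zero_iff _).2 (AddSubgroup.subset_closure (Or.inr rfl))

variable (k) in
/-- The homomorphism from `(kˣ)_ab / {±1}` to the presented group that sends `r` to `[1, r]`. -/
def unitClassesToPresented : UnitClasses k →+ Presented k :=
  MonoidHom.toAdditiveLeft <| QuotientGroup.lift (plusMinusOne k)
    (Abelianization.lift
      (MonoidHom.mk' (fun r : kˣ => Multiplicative.ofAdd (symbolClass r)) fun r s =>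
        congrArg Multiplicative.ofAdd (symbolClass_mul r s))) <| by
    have h : plusMinusOne k ≤ (Abelianization.lift
      (MonoidHom.mk' (fun r : kˣ => Multiplicative.ofAdd (symbolClass r)) fun r s =>
        congrArg Multiplicative.ofAdd (symbolClass_mul r s))).ker := by
      rw [plusMinusOne, Subgroup.map_le_iff_le_comap, Subgroup.zpowers_le]
      exact congrArg Multiplicative.ofAdd symbolClass_neg_one
    exact h

theorem unitClassesToPresented_unitClass (r : kˣ) :
    unitClassesToPresented k (unitClass r) = symbolClass r := rfl

theorem unitClass_surjective : Function.Surjective (unitClass : kˣ → UnitClasses k) :=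
  fun x => by
    obtain ⟨y, rfl⟩ := QuotientGroup.mk_surjective (Additive.toMul x)
    obtain ⟨r, rfl⟩ := QuotientGroup.mk_surjective y
    exact ⟨r, rfl⟩

/-- Every chain in `C_1(k)` is a combination of the cycles `[1, r]`, as the other binary matrix
pairs are degenerate. -/
theorem presentedToHomology_surjective : Function.Surjective (presentedToHomology k) := by
  let f : FreeAbelianGroup kˣ →+ C k 1 :=
    FreeAbelianGroup.lift fun r => chain (system !![1, (r : k)])
  have hf : ∀ x : C k 1, x ∈ f.range := by
    have : AddSubgroup.closure (Set.range (chain : MatrixPair k 2 → C k 1)) ≤ f.range := by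
      refine (AddSubgroup.closure_le _).2 ?_
      rintro _ ⟨p, rfl⟩
      obtain h | ⟨r, rfl⟩ := isDegenerate_or_eq_one_row p
      · rw [chain_of_isDegenerate h]
        exact zero_mem _
      · exact ⟨FreeAbelianGroup.of r, FreeAbelianGroup.lift_apply_of _ _⟩
    rw [closure_range_chain] at this
    exact fun x => this trivial
  let g : FreeAbelianGroup kˣ →+ cycles k 1 :=
    FreeAbelianGroup.lift rowCycle
  have hg : (cycles k 1).subtype.comp g = f := by
    ext r
    simp [f, g, rowCycle]
  intro z
  obtain ⟨z, rfl⟩ := QuotientAddGroup.mk'_surjective _ z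
  obtain ⟨x, hx⟩ := hf z
  refine ⟨QuotientAddGroup.mk x, ?_⟩
  have hx' : g x = z := Subtype.ext ((DFunLike.congr_fun hg x).trans hx)
  rw [← hx']
  refine DFunLike.congr_fun (f := FreeAbelianGroup.lift rowClass)
    (g := (QuotientAddGroup.mk' _).comp g) ?_ x
  ext r
  simp [g, rowClass, homologyClass]

theorem unitClassesToPresented_homologyInvariant (x : Presented k) :
    unitClassesToPresented k (homologyInvariant k (presentedToHomology k x)) = x := by
  have : ((unitClassesToPresented k).comp ((homologyInvariant k).comp
      (presentedToHomology k))).comp (QuotientAddGroup.mk' _) = QuotientAddGroup.mk' _ := by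
    ext r
    change unitClassesToPresented k (homologyInvariant k (presentedToHomology k
      (symbolClass r))) = symbolClass r
    rw [presentedToHomology_symbolClass, homologyInvariant_rowClass,
      unitClassesToPresented_unitClass]
  obtain ⟨x, rfl⟩ := QuotientAddGroup.mk'_surjective _ x
  exact DFunLike.congr_fun this x

/-- The homology invariant is inverse to the composite of `unitClassesToPresented` and
`presentedToHomology`. -/
theorem homologyInvariant_bijective : Function.Bijective (homologyInvariant k) := by
  constructor
  · intro x y h
    obtain ⟨x, rfl⟩ := presentedToHomology_surjective x
    obtain ⟨y, rfl⟩ := presentedToHomology_surjective y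
    rw [← unitClassesToPresented_homologyInvariant x, h, unitClassesToPresented_homologyInvariant]
  · intro y
    obtain ⟨r, rfl⟩ := unitClass_surjective y
    exact ⟨rowClass r, homologyInvariant_rowClass r⟩

theorem presentedToHomology_bijective : Function.Bijective (presentedToHomology k) :=
  ⟨fun x y h => by
    rw [← unitClassesToPresented_homologyInvariant x, h, unitClassesToPresented_homologyInvariant],
    presentedToHomology_surjective⟩

end Presentation

end LinAlgRing

theorem mainTheorem3 (k : Type*) [DivisionRing k] :
    ∃ hz : ∀ r : kˣ, LinAlgRing.chain (LinAlgRing.system !![1, (r : k)]) ∈ LinAlgRing.cycles k 1,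
      (∃ φ : LinAlgRing.Presented k ≃+ LinAlgRing.H k 1,
        ∀ r : kˣ, φ (QuotientAddGroup.mk (FreeAbelianGroup.of r)) =
          LinAlgRing.homologyClass
            ⟨LinAlgRing.chain (LinAlgRing.system !![1, (r : k)]), hz r⟩) ∧
      (∃ ψ : LinAlgRing.H k 1 ≃+ Additive (Abelianization kˣ ⧸ LinAlgRing.plusMinusOne k),
        ∀ r : kˣ, ψ (LinAlgRing.homologyClass
            ⟨LinAlgRing.chain (LinAlgRing.system !![1, (r : k)]), hz r⟩) =
          Additive.ofMul (QuotientGroup.mk (Abelianization.of r))) :=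
  ⟨LinAlgRing.chain_one_row_mem_cycles,
    ⟨AddEquiv.ofBijective _ LinAlgRing.presentedToHomology_bijective,
      LinAlgRing.presentedToHomology_symbolClass⟩,
    ⟨AddEquiv.ofBijective _ LinAlgRing.homologyInvariant_bijective,
      LinAlgRing.homologyInvariant_rowClass⟩⟩
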